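/- All group topologies are Hausdorff. A topological group $G$ is \emph{precompact} if for every neighbourhood $U$ of the identity there is a finite $F\subseteq G$ with $G=FU$; it is \emph{topologically simple} if its only closed normal subgroups are $G$ and the trivial subgroup. The weight of a topological space is the least cardinality of a base, and $\mathfrak{c}=2^{\aleph_0}$. Let $G$ be an infinite abelian group. Then $G$ admits a topologically simple precompact group topology if and only if $G$ is torsion-free and $|G|\leq\mathfrak{c}$. Moreover, if $G$ is torsion-free and $|G|\le\mathfrak{c}$, then for each infinite cardinal $\alpha\leq\mathfrak{c}$ there are exactly $2^{|G|+\alpha}$ topologically simple precompact group topologies on $G$ of weight $\alpha$. -/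

import Mathlib

open scoped Cardinal Topology Pointwise

universe u

/-- The weight of a topological space: the least cardinality of a base. -/
noncomputable def topWeight (X : Type u) [TopologicalSpace X] : Cardinal.{u} :=
  sInf {κ : Cardinal.{u} | ∃ B : Set (Set X), TopologicalSpace.IsTopologicalBasis B ∧ #B = κ}

/-- An (additively written) topological group is precompact if it is Hausdorff and every
neighbourhood `U` of the identity satisfies `F + U = G` for some finite `F ⊆ G`. -/
structure IsPrecompactGroup (G : Type u) [AddGroup G] [TopologicalSpace G] : Prop where
  isTopologicalAddGroup : IsTopologicalAddGroup G
  hausdorff : T2Space G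
  exists_finite_cover : ∀ U ∈ 𝓝 (0 : G), ∃ F : Set G, F.Finite ∧ F + U = Set.univ

/-- A topological group is topologically simple if its only closed normal subgroups are the
trivial subgroup and the whole group. -/
def IsTopSimpleGroup (G : Type u) [AddGroup G] [TopologicalSpace G] : Prop :=
  ∀ N : AddSubgroup G, N.Normal → IsClosed (N : Set G) → N = ⊥ ∨ N = ⊤

/-- The set of topologically simple precompact group topologies on an abstract group `G`. -/
def simplePrecompactTopologies (G : Type u) [AddGroup G] : Set (TopologicalSpace G) :=
  {τ | @IsPrecompactGroup G _ τ ∧ @IsTopSimpleGroup G _ τ}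

/-!
The proof goes through the duality between precompact topologies on an abelian group `G` and groups
of characters of `G`, but uses neither the Peter–Weyl theorem nor Pontryagin duality.

*Necessity.* In a Hausdorff group finite subgroups are closed, so an infinite topologically simple
group has no torsion (`isAddTorsionFree_of_isTopSimpleGroup`). Topological simplicity also yields a
sequence of neighbourhoods of `0` with trivial intersection; with finite covers by their translates,
this injects `G` into a countable product of finite sets (`mk_le_continuum_of_isTopSimpleGroup`).

*Upper bound.* A topology of weight `α` is determined by `α` subsets of `G`
(`mk_topologies_of_weight_le`).

*Lower bound.* A group `H` of characters generates the topology `charTopology H`. The basic fact is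
that averaging a trigonometric polynomial over translates bounds its constant term by its sup-norm
(`norm_le_of_forall_norm_add_sum_le`). Together with the Stone–Weierstrass theorem it shows that the
characters continuous for `charTopology H` are exactly those in `H`, whence different `H` give
different topologies (`charTopology_injective`), and that `charTopology H` is topologically simple
if all nontrivial characters in `H` are injective (`isTopSimpleGroup_charTopology`). It also
implies that the weight is `#H` (`topWeight_charTopology`): only finitely many characters are small
on a given neighbourhood of `0`.

It remains to find `2 ^ (#G + α)` groups `H` of cardinality `α` all of whose nontrivial members are
injective. Fix an embedding `ι` of the group `ℝ` into the circle. For an injective homomorphism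
`f : G →+ ℝ` and a subgroup `A` of `ℝ`, the characters `g ↦ ι (a * f g)`, `a ∈ A`, form such a group
of cardinality `#A`. If `#G ≤ α`, it suffices to vary `A`
(`two_power_weight_le_mk_simplePrecompactTopologies`); if `α < #G`, it suffices to vary `f`
(`two_power_card_le_mk_simplePrecompactTopologies`).
-/

/-! ### Averages of characters -/

open scoped Classical in
theorem tendsto_average_pow_circle (w : Circle) :
    Filter.Tendsto (fun m : ℕ => (m : ℂ)⁻¹ * ∑ k ∈ Finset.range m, (w : ℂ) ^ k) Filter.atTop
      (𝓝 (if w = 1 then 1 else 0)) := by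
  split_ifs with h
  · refine tendsto_const_nhds.congr' ?_
    filter_upwards [Filter.eventually_gt_atTop 0] with m hm
    have : (m : ℂ) ≠ 0 := by exact_mod_cast hm.ne'
    simp [h, this]
  · have hw : (w : ℂ) ≠ 1 := fun h' => h (Circle.ext h')
    have hw' : 0 < ‖(w : ℂ) - 1‖ := norm_pos_iff.2 (sub_ne_zero.2 hw)
    have hinv : Filter.Tendsto (fun m : ℕ => (m : ℝ)⁻¹ * (2 / ‖(w : ℂ) - 1‖)) Filter.atTop
        (𝓝 0) := by
      simpa using (tendsto_inv_atTop_nhds_zero_nat (𝕜 := ℝ)).mul_const (2 / ‖(w : ℂ) - 1‖)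
    refine squeeze_zero_norm (fun m => ?_) hinv
    rw [geom_sum_eq hw, norm_mul, norm_inv, norm_div, Complex.norm_natCast]
    gcongr
    calc ‖(w : ℂ) ^ m - 1‖ ≤ ‖(w : ℂ) ^ m‖ + ‖(1 : ℂ)‖ := norm_sub_le _ _
      _ = 2 := by rw [norm_pow, Circle.norm_coe]; norm_num

/-- The constant term of a trigonometric polynomial is bounded by the sup-norm of the polynomial.
Averaging over the multiples of an element `g` keeps the constant term, does not increase the
sup-norm, and in the limit deletes every character that is nontrivial at `g`. -/
theorem norm_le_of_forall_norm_add_sum_le {Γ ι : Type*} [AddCommGroup Γ] (s : Finset ι)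
    (ψ : ι → AddChar Γ Circle) (c : ι → ℂ) (z : ℂ) (δ : ℝ) (hψ : ∀ i ∈ s, ψ i ≠ 0)
    (h : ∀ x, ‖z + ∑ i ∈ s, c i * (ψ i x : ℂ)‖ ≤ δ) : ‖z‖ ≤ δ := by
  classical
  induction s using Finset.strongInduction with
  | H s ih =>
    rcases s.eq_empty_or_nonempty with rfl | ⟨i₀, hi₀⟩
    · simpa using h 0
    obtain ⟨g, hg⟩ := AddChar.ne_zero_iff.1 (hψ i₀ hi₀)
    refine ih (s.filter fun i => ψ i g = 1)
      (Finset.filter_ssubset.2 ⟨i₀, hi₀, hg⟩)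
      (fun i hi => hψ i (Finset.mem_filter.1 hi).1) fun x => ?_
    have hlim : Filter.Tendsto (fun m : ℕ =>
        (m : ℂ)⁻¹ * (∑ k ∈ Finset.range m, ((1 : Circle) : ℂ) ^ k) * z +
          ∑ i ∈ s, c i * (ψ i x : ℂ) *
            ((m : ℂ)⁻¹ * ∑ k ∈ Finset.range m, (ψ i g : ℂ) ^ k)) Filter.atTop
        (𝓝 (z + ∑ i ∈ s with ψ i g = 1, c i * (ψ i x : ℂ))) := by
      have h1 := (tendsto_average_pow_circle 1).mul_const z
      have h2 := tendsto_finsetSum s fun i _ =>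
        (tendsto_average_pow_circle (ψ i g)).const_mul (c i * (ψ i x : ℂ))
      simpa [Finset.sum_filter] using h1.add h2
    refine le_of_tendsto hlim.norm ?_
    filter_upwards [Filter.eventually_gt_atTop 0] with m hm
    have hm' : (0 : ℝ) < m := by exact_mod_cast hm
    have key : (m : ℂ)⁻¹ * (∑ k ∈ Finset.range m, ((1 : Circle) : ℂ) ^ k) * z +
          ∑ i ∈ s, c i * (ψ i x : ℂ) *
            ((m : ℂ)⁻¹ * ∑ k ∈ Finset.range m, (ψ i g : ℂ) ^ k) =
        (m : ℂ)⁻¹ * ∑ k ∈ Finset.range m, (z + ∑ i ∈ s, c i * (ψ i (x + k • g) : ℂ)) := by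
      rw [Finset.sum_add_distrib, Finset.sum_comm, mul_add, Finset.mul_sum s]
      congr 1
      · simp [mul_assoc, mul_left_comm]
      · refine Finset.sum_congr rfl fun i _ => ?_
        simp only [AddChar.map_add_eq_mul, AddChar.map_nsmul_eq_pow, Circle.coe_mul,
          Circle.coe_pow, Finset.mul_sum]
        exact Finset.sum_congr rfl fun k _ => by ring
    rw [key, norm_mul, norm_inv, Complex.norm_natCast, inv_mul_le_iff₀ hm']
    calc _ ≤ ∑ k ∈ Finset.range m, ‖z + ∑ i ∈ s, c i * (ψ i (x + k • g) : ℂ)‖ :=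
          norm_sum_le _ _
      _ ≤ ∑ k ∈ Finset.range m, δ := Finset.sum_le_sum fun k _ => h _
      _ = m * δ := by simp

/-- A character which stays uniformly close to `1` is trivial. -/
theorem addChar_eq_zero_of_norm_sub_one_le {Γ : Type*} [AddCommGroup Γ] (χ : AddChar Γ Circle)
    (δ : ℝ) (hδ : δ < 1) (h : ∀ x, ‖(χ x : ℂ) - 1‖ ≤ δ) : χ = 0 := by
  by_contra hχ
  have := norm_le_of_forall_norm_add_sum_le {()} (fun _ => χ) (fun _ => 1) (-1) δ
    (fun _ _ => hχ) fun x => by simpa [neg_add_eq_sub] using h x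
  simp at this
  linarith

/-! ### Trigonometric polynomials with frequencies in a group of characters -/

/-- The complex-valued functions on `G` spanned by the characters in `H`; they form a
star-subalgebra because `H` is a group. -/
def trigPolynomials {G : Type*} [AddCommGroup G] (H : AddSubgroup (AddChar G Circle)) :
    StarSubalgebra ℂ (G → ℂ) where
  carrier := Submodule.span ℂ (Set.range fun (χ : H) (g : G) => ((χ : AddChar G Circle) g : ℂ))
  add_mem' := fun ha hb => Submodule.add_mem _ ha hb
  mul_mem' := fun {a b} ha hb => by
    refine Submodule.span_induction₂ (p := fun a b _ _ => a * b ∈ Submodule.span ℂ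
      (Set.range fun (χ : H) (g : G) => ((χ : AddChar G Circle) g : ℂ)))
      ?_ ?_ ?_ ?_ ?_ ?_ ?_ ha hb
    · rintro _ _ ⟨χ, rfl⟩ ⟨η, rfl⟩
      exact Submodule.subset_span ⟨χ + η, by ext g; simp⟩
    · intro y _; simp
    · intro x _; simp
    · intro x y z _ _ _ h1 h2; rw [add_mul]; exact Submodule.add_mem _ h1 h2
    · intro x y z _ _ _ h1 h2; rw [mul_add]; exact Submodule.add_mem _ h1 h2
    · intro r x y _ _ h; rw [smul_mul_assoc]; exact Submodule.smul_mem _ _ h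
    · intro r x y _ _ h; rw [mul_smul_comm]; exact Submodule.smul_mem _ _ h
  algebraMap_mem' := fun r => by
    have h1 : (fun g : G => (((0 : H) : AddChar G Circle) g : ℂ)) ∈ Submodule.span ℂ
        (Set.range fun (χ : H) (g : G) => ((χ : AddChar G Circle) g : ℂ)) :=
      Submodule.subset_span ⟨0, rfl⟩
    have h2 := Submodule.smul_mem _ r h1
    rwa [show (r • fun g : G => (((0 : H) : AddChar G Circle) g : ℂ)) = algebraMap ℂ (G → ℂ) r by
      ext g; simp] at h2
  star_mem' := fun {a} ha => by
    refine Submodule.span_induction (p := fun a _ => star a ∈ Submodule.span ℂ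
      (Set.range fun (χ : H) (g : G) => ((χ : AddChar G Circle) g : ℂ))) ?_ ?_ ?_ ?_ ha
    · rintro _ ⟨χ, rfl⟩
      refine Submodule.subset_span ⟨-χ, ?_⟩
      ext g
      simp [AddChar.map_neg_eq_inv, ← Circle.coe_inv_eq_conj]
    · simp
    · intro x y _ _ h1 h2; rw [star_add]; exact Submodule.add_mem _ h1 h2
    · intro r x _ h; rw [star_smul]; exact Submodule.smul_mem _ _ h

/-- If the characters in `H` extend along `θ : G → X` to continuous functions separating the points
of the compact space `X`, every continuous function on `X` is, along `θ`, a uniform limit of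
trigonometric polynomials. This is the Stone–Weierstrass theorem. -/
theorem exists_trigPolynomial_near {G X : Type*} [AddCommGroup G]
    (H : AddSubgroup (AddChar G Circle)) [TopologicalSpace X] [CompactSpace X] (θ : G → X)
    (E : H → C(X, Circle)) (hE : ∀ (χ : H) g, E χ (θ g) = (χ : AddChar G Circle) g)
    (hsep : ∀ x y, (∀ χ, E χ x = E χ y) → x = y) (F : C(X, ℂ)) {ε : ℝ} (hε : 0 < ε) :
    ∃ (s : Finset H) (c : H → ℂ),
      ∀ g, ‖F (θ g) - ∑ χ ∈ s, c χ * ((χ : AddChar G Circle) g : ℂ)‖ ≤ ε := by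
  let pull : C(X, ℂ) →⋆ₐ[ℂ] (G → ℂ) :=
    { toFun := fun f g => f (θ g)
      map_one' := rfl
      map_mul' := fun _ _ => rfl
      map_zero' := rfl
      map_add' := fun _ _ => rfl
      commutes' := fun _ => rfl
      map_star' := fun _ => rfl }
  let A : StarSubalgebra ℂ C(X, ℂ) := (trigPolynomials H).comap pull
  have hA : A.SeparatesPoints := by
    intro x y hxy
    obtain ⟨χ, hχ⟩ : ∃ χ, E χ x ≠ E χ y := by
      by_contra! hcon
      exact hxy (hsep x y hcon)
    refine ⟨_, ⟨⟨fun x => (E χ x : ℂ), by fun_prop⟩, ?_, rfl⟩, fun h => hχ (Circle.ext h)⟩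
    refine Submodule.subset_span ⟨χ, ?_⟩
    ext g
    exact congrArg _ (hE χ g).symm
  have htop := ContinuousMap.starSubalgebra_topologicalClosure_eq_top_of_separatesPoints A hA
  have hF : F ∈ closure (A : Set C(X, ℂ)) := by
    rw [← StarSubalgebra.topologicalClosure_coe, htop]; trivial
  obtain ⟨p, hpA, hp⟩ := Metric.mem_closure_iff.1 hF ε hε
  have hpA' : pull p ∈ Submodule.span ℂ
      (Set.range fun (χ : H) (g : G) => ((χ : AddChar G Circle) g : ℂ)) := hpA
  obtain ⟨c, hc⟩ := Finsupp.mem_span_range_iff_exists_finsupp.1 hpA'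
  refine ⟨c.support, c, fun g => ?_⟩
  have hcg : p (θ g) = ∑ χ ∈ c.support, c χ * ((χ : AddChar G Circle) g : ℂ) := by
    have := congrFun hc g
    have e : p (θ g) = pull p g := rfl
    rw [e, ← this]
    simp [Finsupp.sum]
  rw [← hcg, ← dist_eq_norm]
  exact (ContinuousMap.dist_apply_le_dist (θ g)).trans hp.le

/-! ### The topology generated by a group of characters -/

/-- The coarsest topology on `G` making all characters in `H` continuous. -/
noncomputable abbrev charTopology {G : Type*} [AddCommGroup G] (H : AddSubgroup (AddChar G Circle)) :
    TopologicalSpace G :=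
  .induced (fun g (χ : H) => (χ : AddChar G Circle) g) Pi.topologicalSpace

theorem neBot_comap_of_mem_closure_range {ι X : Type*} [TopologicalSpace X] {f : ι → X} {x : X}
    (hx : x ∈ closure (Set.range f)) : (Filter.comap f (𝓝 x)).NeBot :=
  Filter.comap_neBot fun t ht => by
    obtain ⟨_, hy, i, rfl⟩ := mem_closure_iff_nhds.1 hx t ht
    exact ⟨i, hy⟩

section charTopology

variable {G : Type*} [AddCommGroup G] (H : AddSubgroup (AddChar G Circle))

theorem continuous_eval_charTopology :
    @Continuous _ _ (charTopology H) _ fun g (χ : H) => (χ : AddChar G Circle) g :=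
  continuous_induced_dom

theorem mem_nhds_charTopology_iff {x : G} {U : Set G} :
    U ∈ @nhds G (charTopology H) x ↔
      ∃ V ∈ 𝓝 fun χ : H => (χ : AddChar G Circle) x,
        (fun g (χ : H) => (χ : AddChar G Circle) g) ⁻¹' V ⊆ U := by
  rw [charTopology, nhds_induced, Filter.mem_comap]

theorem isTopologicalAddGroup_charTopology :
    @IsTopologicalAddGroup G (charTopology H) _ := by
  let _ := charTopology H
  have hφ := continuous_eval_charTopology H
  refine @IsTopologicalAddGroup.mk G _ _ ⟨?_⟩ ⟨?_⟩
  · refine continuous_induced_rng.2 ?_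
    have : Continuous fun p : G × G =>
        (fun χ : H => (χ : AddChar G Circle) p.1) * fun χ : H => (χ : AddChar G Circle) p.2 :=
      (hφ.comp continuous_fst).mul (hφ.comp continuous_snd)
    convert this using 1
    ext p χ
    simp [AddChar.map_add_eq_mul]
  · refine continuous_induced_rng.2 ?_
    convert hφ.inv using 1
    ext p χ
    simp [AddChar.map_neg_eq_inv]

/-- The topology generated by a separating group of characters is precompact: it is induced from
the compact group of all functions from `H` to the circle. -/
theorem isPrecompactGroup_charTopology (hsep : ∀ g ≠ 0, ∃ χ ∈ H, χ g ≠ 1) :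
    @IsPrecompactGroup G _ (charTopology H) := by
  let _ := charTopology H
  have hφ := continuous_eval_charTopology H
  refine @IsPrecompactGroup.mk G _ _ (isTopologicalAddGroup_charTopology H) ?_ ?_
  · refine T2Space.of_injective_continuous (fun a b hab => ?_) hφ
    by_contra hne
    obtain ⟨χ, hχ, h1⟩ := hsep (a - b) (sub_ne_zero.2 hne)
    refine h1 ?_
    rw [AddChar.map_sub_eq_div, div_eq_one]
    exact congrFun hab ⟨χ, hχ⟩
  · intro U hU
    obtain ⟨V, hV, hVU⟩ := (mem_nhds_charTopology_iff H).1 hU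
    have h1 : (fun χ : H => (χ : AddChar G Circle) 0) = 1 := by ext; simp
    rw [h1] at hV
    have hdiv : Filter.Tendsto (fun p : (H → Circle) × (H → Circle) => p.1 / p.2)
        (𝓝 1 ×ˢ 𝓝 1) (𝓝 1) := by
      rw [← nhds_prod_eq]
      have : Continuous fun p : (H → Circle) × (H → Circle) => p.1 / p.2 := by fun_prop
      simpa using this.tendsto (1, 1)
    obtain ⟨W, hW, hWV⟩ := Filter.mem_prod_same_iff.1 (hdiv hV)
    obtain ⟨t, ht⟩ := (isCompact_univ (X := H → Circle)).elim_nhds_subcover (fun k => (k * ·) '' W)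
      fun k _ => by
        have := (Homeomorph.mulLeft k).isOpenMap.image_mem_nhds hW
        simpa using this
    have hex : ∀ k : H → Circle, ∃ a : G, ∀ g : G,
        (fun χ : H => (χ : AddChar G Circle) g) ∈ (k * ·) '' W →
        (fun χ : H => (χ : AddChar G Circle) a) ∈ (k * ·) '' W := by
      intro k
      by_cases h : ∃ g : G, (fun χ : H => (χ : AddChar G Circle) g) ∈ (k * ·) '' W
      · obtain ⟨a, ha⟩ := h
        exact ⟨a, fun _ _ => ha⟩
      · exact ⟨0, fun g hg => (h ⟨g, hg⟩).elim⟩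
    choose a ha using hex
    refine ⟨a '' t, t.finite_toSet.image _, Set.eq_univ_of_forall fun g => ?_⟩
    have hg := ht.2 (Set.mem_univ fun χ : H => (χ : AddChar G Circle) g)
    simp only [Set.mem_iUnion] at hg
    obtain ⟨k, hk, hgk⟩ := hg
    refine Set.mem_add.2 ⟨a k, ⟨k, hk, rfl⟩, g - a k, hVU ?_, by abel⟩
    obtain ⟨w, hw, hw'⟩ := ha k g hgk
    obtain ⟨w', hw₁, hw₂⟩ := hgk
    have : (w', w) ∈ (fun p : (H → Circle) × (H → Circle) => p.1 / p.2) ⁻¹' V := hWV ⟨hw₁, hw⟩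
    have e : (fun χ : H => (χ : AddChar G Circle) (g - a k)) = w' / w := by
      ext χ
      have e1 : k χ * w χ = (χ : AddChar G Circle) (a k) := congrFun hw' χ
      have e2 : k χ * w' χ = (χ : AddChar G Circle) g := congrFun hw₂ χ
      simp [AddChar.map_sub_eq_div, ← e1, ← e2]
    rwa [Set.mem_preimage, e]

/-- A character continuous for the topology generated by `H` belongs to `H`. On the closure of the
image of `G` in `(H → Circle) × Circle` the coordinates in `H` already separate points, so the last
coordinate, which extends `χ`, is approximated by trigonometric polynomials with frequencies in
`H`; unless `χ ∈ H`, the averaging argument forbids this. -/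
theorem mem_of_continuous_charTopology (χ : AddChar G Circle)
    (hχ : @Continuous _ _ (charTopology H) _ χ) : χ ∈ H := by
  by_contra hmem
  let _ := charTopology H
  let Φ : G → (H → Circle) × Circle := fun g => (fun η => (η : AddChar G Circle) g, χ g)
  let K := closure (Set.range Φ)
  have : CompactSpace K := isCompact_iff_compactSpace.1 isClosed_closure.isCompact
  have hsep : ∀ x y : K, (∀ η, x.1.1 η = y.1.1 η) → x = y := by
    rintro ⟨x, hx⟩ ⟨y, hy⟩ h
    have hxy : x.1 = y.1 := funext h
    suffices x.2 = y.2 from Subtype.ext (Prod.ext hxy this)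
    have hx' : (Filter.comap Φ (𝓝 x)).NeBot := neBot_comap_of_mem_closure_range hx
    have hy' : (Filter.comap Φ (𝓝 y)).NeBot := neBot_comap_of_mem_closure_range hy
    have tx : Filter.Tendsto (fun p : G × G => Φ p.1)
        (Filter.comap Φ (𝓝 x) ×ˢ Filter.comap Φ (𝓝 y)) (𝓝 x) :=
      Filter.tendsto_comap.comp Filter.tendsto_fst
    have ty : Filter.Tendsto (fun p : G × G => Φ p.2)
        (Filter.comap Φ (𝓝 x) ×ˢ Filter.comap Φ (𝓝 y)) (𝓝 y) :=
      Filter.tendsto_comap.comp Filter.tendsto_snd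
    have td := tx.div' ty
    have t0 : Filter.Tendsto (fun p : G × G => p.1 - p.2)
        (Filter.comap Φ (𝓝 x) ×ˢ Filter.comap Φ (𝓝 y)) (𝓝 0) := by
      rw [show 𝓝 (0 : G) = _ from nhds_induced _ _, Filter.tendsto_comap_iff]
      have := (continuous_fst.tendsto _).comp td
      convert this using 1
      · ext p η
        simp [Φ, AddChar.map_sub_eq_div]
      · congr 1
        ext η
        simp [hxy]
    have t1 : Filter.Tendsto (fun p : G × G => χ (p.1 - p.2))
        (Filter.comap Φ (𝓝 x) ×ˢ Filter.comap Φ (𝓝 y)) (𝓝 1) := by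
      have := (hχ.tendsto 0).comp t0
      simpa [Function.comp_def] using this
    have t2 := (continuous_snd.tendsto _).comp td
    have := tendsto_nhds_unique t1 (by
      convert t2 using 1
      ext p
      simp [Φ, AddChar.map_sub_eq_div])
    exact (div_eq_one.1 (by simpa using this.symm))
  obtain ⟨s, c, hsc⟩ := exists_trigPolynomial_near H (X := K)
    (fun g => ⟨Φ g, subset_closure ⟨g, rfl⟩⟩) (fun η => ⟨fun k => k.1.1 η, by fun_prop⟩)
    (fun η g => rfl) hsep ⟨fun k => (k.1.2 : ℂ), by fun_prop⟩ (ε := 1 / 2) (by norm_num)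
  have := norm_le_of_forall_norm_add_sum_le s (fun η => (η : AddChar G Circle) - χ)
    (fun η => -c η) 1 (1 / 2)
    (fun η _ h0 => hmem (by rw [← sub_eq_zero.1 h0]; exact η.2)) fun g => by
      have hg := hsc g
      have e : (1 : ℂ) + ∑ η ∈ s, -c η * (((η : AddChar G Circle) - χ) g : ℂ) =
          (χ g : ℂ)⁻¹ * ((χ g : ℂ) - ∑ η ∈ s, c η * ((η : AddChar G Circle) g : ℂ)) := by
        rw [mul_sub, inv_mul_cancel₀ (Circle.coe_ne_zero _), Finset.mul_sum, sub_eq_add_neg,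
          ← Finset.sum_neg_distrib]
        congr 1
        refine Finset.sum_congr rfl fun η _ => ?_
        rw [AddChar.sub_apply', Circle.coe_div]
        ring
      rw [e, norm_mul, norm_inv, Circle.norm_coe, inv_one, one_mul]
      exact hg
  norm_num at this

theorem charTopology_injective :
    Function.Injective (charTopology : AddSubgroup (AddChar G Circle) → TopologicalSpace G) := by
  have key : ∀ H H' : AddSubgroup (AddChar G Circle), charTopology H = charTopology H' →
      H ≤ H' := by
    intro H H' h χ hχ
    refine mem_of_continuous_charTopology H' χ ?_
    rw [← h]
    let _ := charTopology H
    exact (continuous_apply (⟨χ, hχ⟩ : H)).comp (continuous_eval_charTopology H)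
  exact fun H H' h => le_antisymm (key H H' h) (key H' H h.symm)

/-- If every nontrivial character in `H` is injective, the topology generated by `H` is
topologically simple. A nonzero closed subgroup `N` and a coset `x + N` disjoint from it would be
separated by a continuous function, hence by a trigonometric polynomial with frequencies in `H`;
but averaging over `N` leaves only the constant term of the polynomial on both cosets. -/
theorem isTopSimpleGroup_charTopology (hinj : ∀ χ ∈ H, χ ≠ 0 → Function.Injective χ) :
    @IsTopSimpleGroup G _ (charTopology H) := by
  classical
  let _ := charTopology H
  intro N _ hN
  by_contra! hcon
  obtain ⟨hbot, htop⟩ := hcon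
  obtain ⟨n₀, hn₀, hn₀'⟩ := (AddSubgroup.bot_or_exists_ne_zero N).resolve_left hbot
  obtain ⟨x, hx⟩ : ∃ x, x ∉ N := by
    by_contra! h
    exact htop (eq_top_iff.2 fun y _ => h y)
  let φ : G → H → Circle := fun g χ => (χ : AddChar G Circle) g
  have hdisj : Disjoint (closure (Set.range fun n : N => φ n))
      (closure (Set.range fun n : N => φ (x + n))) := by
    refine Set.disjoint_left.2 fun z hz hz' => hx ?_
    have hb := neBot_comap_of_mem_closure_range hz
    have hb' := neBot_comap_of_mem_closure_range hz'
    have t1 : Filter.Tendsto (fun p : N × N => φ p.1)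
        (Filter.comap (fun n : N => φ n) (𝓝 z) ×ˢ Filter.comap (fun n : N => φ (x + n)) (𝓝 z))
        (𝓝 z) := Filter.tendsto_comap.comp Filter.tendsto_fst
    have t2 : Filter.Tendsto (fun p : N × N => φ (x + p.2))
        (Filter.comap (fun n : N => φ n) (𝓝 z) ×ˢ Filter.comap (fun n : N => φ (x + n)) (𝓝 z))
        (𝓝 z) := Filter.tendsto_comap.comp Filter.tendsto_snd
    have t3 : Filter.Tendsto (fun p : N × N => ((p.1 - p.2 : N) : G))
        (Filter.comap (fun n : N => φ n) (𝓝 z) ×ˢ Filter.comap (fun n : N => φ (x + n)) (𝓝 z))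
        (𝓝 x) := by
      rw [show 𝓝 x = _ from nhds_induced _ _, Filter.tendsto_comap_iff]
      have := (t1.div' t2).mul_const (φ x)
      convert this using 1
      · funext p χ
        change (χ : AddChar G Circle) (p.1 - p.2 : N) = (χ : AddChar G Circle) p.1 /
          (χ : AddChar G Circle) (x + p.2) * (χ : AddChar G Circle) x
        rw [AddSubgroup.coe_sub, AddChar.map_sub_eq_div, AddChar.map_add_eq_mul,
          mul_comm ((χ : AddChar G Circle) x), ← div_div, div_mul_cancel]
      · simp [φ]
    exact hN.mem_of_tendsto t3 (Filter.Eventually.of_forall fun p => (p.1 - p.2).2)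
  obtain ⟨F, hF0, hF1, -⟩ := exists_continuous_zero_one_of_isClosed isClosed_closure
    isClosed_closure hdisj
  obtain ⟨s, c, hsc⟩ := exists_trigPolynomial_near H φ (fun χ => ⟨fun k => k χ, by fun_prop⟩)
    (fun χ g => rfl) (fun a b h => funext h) ⟨fun k => (F k : ℂ), by fun_prop⟩
    (ε := 1 / 3) (by norm_num)
  -- On the coset of `y`, the polynomial is its constant term plus nontrivial characters of `N`.
  have hcoset : ∀ (y : G) (w : ℂ), (∀ n : N, (F (φ (y + n)) : ℂ) = w) →
      ‖w - ∑ χ ∈ s with χ = 0, c χ‖ ≤ 1 / 3 := by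
    intro y w hw
    refine norm_le_of_forall_norm_add_sum_le (Γ := N) (s.filter fun χ => ¬ χ = 0)
      (fun χ : H => (χ : AddChar G Circle).compAddMonoidHom N.subtype)
      (fun χ : H => -c χ * ((χ : AddChar G Circle) y : ℂ)) _ _ ?_ fun n => ?_
    · intro χ hχ h0
      refine hn₀' (hinj χ χ.2
        (fun h => (Finset.mem_filter.1 hχ).2 (Subtype.ext h)) ?_)
      simpa using DFunLike.congr_fun h0 (⟨n₀, hn₀⟩ : N)
    · convert hsc (y + n) using 2
      have e := hw n
      rw [← Finset.sum_filter_add_sum_filter_not s (fun χ => χ = 0)]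
      simp only [ContinuousMap.coe_mk, e]
      rw [← sub_sub, sub_eq_add_neg (w - _), ← Finset.sum_neg_distrib]
      congr 1
      · congr 1
        refine Finset.sum_congr rfl fun χ hχ => ?_
        simp [(Finset.mem_filter.1 hχ).2]
      · refine Finset.sum_congr rfl fun χ _ => ?_
        simp [AddChar.map_add_eq_mul, mul_assoc]
  have h0 := hcoset 0 0 fun n => by
    rw [zero_add]
    exact_mod_cast hF0 (subset_closure ⟨n, rfl⟩)
  have h1 := hcoset x 1 fun n => by
    exact_mod_cast hF1 (subset_closure ⟨n, rfl⟩)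
  have := norm_sub_le (1 - ∑ χ ∈ s with χ = 0, c χ)
    (0 - ∑ χ ∈ s with χ = 0, c χ)
  simp only [sub_sub_sub_cancel_right, sub_zero, norm_one] at this
  linarith

end charTopology

/-! ### The weight of a precompact group -/

theorem exists_isTopologicalBasis_mk_eq_topWeight (X : Type u) [TopologicalSpace X] :
    ∃ B : Set (Set X), TopologicalSpace.IsTopologicalBasis B ∧ #B = topWeight X :=
  csInf_mem (s := {κ : Cardinal.{u} | ∃ B : Set (Set X),
    TopologicalSpace.IsTopologicalBasis B ∧ #B = κ})
    ⟨_, _, TopologicalSpace.isTopologicalBasis_opens, rfl⟩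

theorem infinite_of_isTopologicalBasis {X : Type u} [TopologicalSpace X] [T0Space X] [Infinite X]
    {B : Set (Set X)} (hB : TopologicalSpace.IsTopologicalBasis B) : Infinite B := by
  by_contra hfin
  have : Finite B := not_infinite_iff_finite.1 hfin
  refine not_finite_iff_infinite.2 ‹Infinite X› (Finite.of_injective
    (fun x : X => {b : B | x ∈ (b : Set X)}) fun x y hxy => ?_)
  refine (TopologicalSpace.IsTopologicalBasis.inseparable_iff hB).2 (fun b hb => ?_) |>.eq
  exact Set.ext_iff.1 hxy ⟨b, hb⟩

theorem topWeight_charTopology_le {G : Type u} [AddCommGroup G]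
    (H : AddSubgroup (AddChar G Circle)) (hH : ℵ₀ ≤ #H) :
    @topWeight G (charTopology H) ≤ #H := by
  classical
  let _ := charTopology H
  obtain ⟨e, he⟩ := (TopologicalSpace.countable_countableBasis Circle).exists_eq_range
    (Set.nonempty_iff_ne_empty.2 fun h => by
      have := (TopologicalSpace.isBasis_countableBasis Circle).sUnion_eq
      rw [h, Set.sUnion_empty] at this
      exact Set.empty_ne_univ this)
  let σ : H × ℕ → Set G := fun p => (p.1 : AddChar G Circle) ⁻¹' e p.2
  have hgen : charTopology H = TopologicalSpace.generateFrom (Set.range σ) := by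
    have h1 : (inferInstance : TopologicalSpace Circle) =
        TopologicalSpace.generateFrom (Set.range e) := by
      rw [← he]
      exact (TopologicalSpace.isBasis_countableBasis Circle).eq_generateFrom
    have h2 : Set.range σ = ⋃ χ : H, Set.preimage (χ : AddChar G Circle) '' Set.range e := by
      ext U
      simp [σ]
    have h3 : ∀ χ : H, TopologicalSpace.generateFrom
        (Set.preimage (χ : AddChar G Circle) '' Set.range e) =
        TopologicalSpace.induced (χ : AddChar G Circle) inferInstance := by
      intro χ
      rw [h1, induced_generateFrom_eq]
    rw [h2, generateFrom_iUnion]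
    simp only [h3]
    rw [charTopology, Pi.topologicalSpace, induced_iInf]
    simp only [induced_compose]
    rfl
  have hB := TopologicalSpace.isTopologicalBasis_of_subbasis hgen
  have hle : topWeight G ≤ #((fun f => ⋂₀ f) '' {f : Set (Set G) | f.Finite ∧ f ⊆ Set.range σ}) :=
    csInf_le' ⟨_, hB, rfl⟩
  refine hle.trans ?_
  have hinf : Infinite H := Cardinal.infinite_iff.2 hH
  calc _ ≤ #(Set.range fun t : Finset (H × ℕ) => ⋂ p ∈ t, σ p) := by
        refine Cardinal.mk_le_mk_of_subset ?_
        rintro _ ⟨f, ⟨hf, hfs⟩, rfl⟩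
        obtain ⟨f, rfl⟩ := hf.exists_finset_coe
        rw [← Set.image_univ] at hfs
        obtain ⟨t, -, rfl⟩ := Finset.subset_set_image_iff.1 hfs
        refine ⟨t, ?_⟩
        simp
    _ ≤ #(Finset (H × ℕ)) := Cardinal.mk_range_le
    _ = #H := by
        rw [Cardinal.mk_finset_of_infinite, Cardinal.mk_prod]
        simp [Cardinal.mul_aleph0_eq hH]

/-- Only finitely many characters are small on a set finitely many translates of which cover the
group: two such characters which are close on the set of translations are uniformly close. -/
theorem finite_setOf_addChar_small_on {G : Type*} [AddCommGroup G] {F U : Set G} (hF : F.Finite)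
    (hFU : F + U = Set.univ) :
    {χ : AddChar G Circle | ∀ u ∈ U, ‖(χ u : ℂ) - 1‖ ≤ 1 / 4}.Finite := by
  have := hF.fintype
  obtain ⟨t, -, ht, htcov⟩ := (isCompact_univ (X := F → Circle)).finite_cover_balls
    (e := 1 / 8) (by norm_num)
  have hex : ∀ χ : AddChar G Circle, ∃ p ∈ t, dist (fun f : F => χ f) p < 1 / 8 := by
    intro χ
    simpa using htcov (Set.mem_univ fun f : F => χ f)
  choose p hpt hp using hex
  refine Set.Finite.of_injOn (f := p) (fun χ _ => hpt χ) (fun χ hχ η hη hpe => ?_) ht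
  have hd : ∀ f : F, ‖(χ f : ℂ) - η f‖ ≤ 1 / 4 := by
    intro f
    have h1 := hp χ
    have h2 := hp η
    rw [← hpe, dist_comm] at h2
    have h3 := (dist_triangle (fun f : F => χ f) (p χ) (fun f : F => η f))
    have h4 := dist_le_pi_dist (fun f : F => χ f) (fun f : F => η f) f
    have h5 : ‖(χ f : ℂ) - η f‖ = dist (χ f) (η f) := by
      rw [← dist_eq_norm]; rfl
    linarith
  rw [← sub_eq_zero]
  refine addChar_eq_zero_of_norm_sub_one_le _ (3 / 4) (by norm_num) fun x => ?_
  obtain ⟨f, hf, u, hu, rfl⟩ := Set.mem_add.1 (hFU ▸ Set.mem_univ x)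
  have hn : ‖((χ - η) (f + u) : ℂ) - 1‖ = ‖(χ (f + u) : ℂ) - η (f + u)‖ := by
    rw [AddChar.sub_apply', Circle.coe_div, div_sub_one (Circle.coe_ne_zero _), norm_div,
      Circle.norm_coe, div_one]
  have hs : (χ (f + u) : ℂ) - η (f + u) =
      χ f * ((χ u : ℂ) - 1) + ((χ f : ℂ) - η f) - η f * ((η u : ℂ) - 1) := by
    rw [AddChar.map_add_eq_mul, AddChar.map_add_eq_mul, Circle.coe_mul, Circle.coe_mul]
    ring
  rw [hn, hs]
  have b1 := hχ u hu
  have b2 := hη u hu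
  have b3 := hd ⟨f, hf⟩
  calc _ ≤ ‖(χ f : ℂ) * ((χ u : ℂ) - 1)‖ + ‖(χ f : ℂ) - η f‖ +
        ‖(η f : ℂ) * ((η u : ℂ) - 1)‖ :=
        (norm_sub_le _ _).trans (by gcongr; exact norm_add_le _ _)
    _ ≤ 3 / 4 := by
        rw [norm_mul, norm_mul, Circle.norm_coe, Circle.norm_coe, one_mul, one_mul]
        linarith

/-- The number of continuous characters of an infinite precompact group is at most its weight: a
character is small on a basic neighbourhood of `0`, and each such neighbourhood serves only finitely
many characters. -/
theorem mk_le_topWeight_of_continuous {G : Type u} [AddCommGroup G] [Infinite G]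
    [TopologicalSpace G] (hG : IsPrecompactGroup G) (H : AddSubgroup (AddChar G Circle))
    (hc : ∀ χ ∈ H, Continuous χ) : #H ≤ topWeight G := by
  have := hG.hausdorff
  obtain ⟨B, hB, hBw⟩ := exists_isTopologicalBasis_mk_eq_topWeight G
  have hBinf := infinite_of_isTopologicalBasis hB
  have hex : ∀ χ : H, ∃ b : B, (b : Set G) ∈ 𝓝 (0 : G) ∧
      ∀ u ∈ (b : Set G), ‖((χ : AddChar G Circle) u : ℂ) - 1‖ ≤ 1 / 4 := by
    intro χ
    have hcont : Continuous fun u => ‖((χ : AddChar G Circle) u : ℂ) - 1‖ := by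
      have := hc χ χ.2
      fun_prop
    have hopen : IsOpen {u : G | ‖((χ : AddChar G Circle) u : ℂ) - 1‖ < 1 / 4} :=
      isOpen_lt hcont continuous_const
    obtain ⟨b, hb, h0, hsub⟩ := hB.exists_subset_of_mem_open
      (show (0 : G) ∈ {u : G | ‖((χ : AddChar G Circle) u : ℂ) - 1‖ < 1 / 4} by simp) hopen
    exact ⟨⟨b, hb⟩, hB.mem_nhds hb h0, fun u hu => (hsub hu).le⟩
  choose f hf0 hfs using hex
  rw [← hBw]
  have hle := Cardinal.mk_le_mk_mul_of_mk_preimage_le (c := ℵ₀) f fun b => by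
    rw [Cardinal.le_aleph0_iff_set_countable]
    by_cases hb : (b : Set G) ∈ 𝓝 (0 : G)
    · obtain ⟨F, hF, hFU⟩ := hG.exists_finite_cover _ hb
      refine (Set.Finite.subset ((finite_setOf_addChar_small_on hF hFU).preimage
        Subtype.val_injective.injOn) fun χ hχ => ?_).countable
      have hχ' : f χ = b := hχ
      exact hχ' ▸ hfs χ
    · refine (Set.countable_empty).mono fun χ hχ => hb ?_
      have hχ' : f χ = b := hχ
      exact hχ' ▸ hf0 χ
  rwa [Cardinal.mul_aleph0_eq (Cardinal.infinite_iff.1 hBinf)] at hle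

theorem topWeight_charTopology {G : Type u} [AddCommGroup G] [Infinite G]
    (H : AddSubgroup (AddChar G Circle)) (hH : ℵ₀ ≤ #H) (hsep : ∀ g ≠ 0, ∃ χ ∈ H, χ g ≠ 1) :
    @topWeight G (charTopology H) = #H := by
  refine le_antisymm (topWeight_charTopology_le H hH) ?_
  let _ := charTopology H
  refine mk_le_topWeight_of_continuous (isPrecompactGroup_charTopology H hsep) H fun χ hχ => ?_
  exact (continuous_apply (⟨χ, hχ⟩ : H)).comp (continuous_eval_charTopology H)

/-! ### Consequences of topological simplicity -/

/-- The finite subgroups of a Hausdorff group are closed, so an infinite topologically simple group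
has no nonzero element of finite order. -/
theorem isAddTorsionFree_of_isTopSimpleGroup {G : Type u} [AddCommGroup G] [Infinite G]
    [TopologicalSpace G] [T1Space G] (hG : IsTopSimpleGroup G) : IsAddTorsionFree G := by
  rw [isAddTorsionFree_iff_not_isOfFinAddOrder]
  intro x hx hfin
  have hf : (AddSubgroup.zmultiples x : Set G).Finite := by
    simpa using hfin
  rcases hG (AddSubgroup.zmultiples x) inferInstance hf.isClosed with h | h
  · exact hx (AddSubgroup.zmultiples_eq_bot.1 h)
  · rw [h] at hf
    exact Set.infinite_univ hf

/-- In a topologically simple precompact group, some sequence of neighbourhoods `U n` of `0` with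
`U (n + 1) - U (n + 1) ⊆ U n` has trivial intersection, the intersection being a proper closed
subgroup. An element is then determined by the translates of the `U n` containing it, chosen from a
finite cover for each `n`. -/
theorem mk_le_continuum_of_isTopSimpleGroup {G : Type u} [AddCommGroup G] [Infinite G]
    [TopologicalSpace G] (hp : IsPrecompactGroup G) (hs : IsTopSimpleGroup G) : #G ≤ 𝔠 := by
  have := hp.isTopologicalAddGroup
  have := hp.hausdorff
  obtain ⟨x, hx⟩ := exists_ne (0 : G)
  have hstep : ∀ U : {U : Set G // U ∈ 𝓝 0}, ∃ V : {U : Set G // U ∈ 𝓝 0},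
      ∀ a ∈ V.1, ∀ b ∈ V.1, a - b ∈ U.1 := by
    rintro ⟨U, hU⟩
    have ht : Filter.Tendsto (fun p : G × G => p.1 - p.2) (𝓝 0 ×ˢ 𝓝 0) (𝓝 0) := by
      rw [← nhds_prod_eq]
      simpa using (continuous_sub (G := G)).tendsto (0, 0)
    obtain ⟨V, hV, hVU⟩ := Filter.mem_prod_same_iff.1 (ht hU)
    exact ⟨⟨V, hV⟩, fun a ha b hb => hVU (Set.mk_mem_prod ha hb)⟩
  choose next hnext using hstep
  let U : ℕ → {U : Set G // U ∈ 𝓝 0} := fun n =>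
    n.rec ⟨{x}ᶜ, isOpen_compl_singleton.mem_nhds (by simpa using hx.symm)⟩ fun _ => next
  have hU : ∀ n, ∀ a ∈ (U (n + 1)).1, ∀ b ∈ (U (n + 1)).1, a - b ∈ (U n).1 :=
    fun n => hnext (U n)
  have hzero : ∀ n, (0 : G) ∈ (U n).1 := fun n => mem_of_mem_nhds (U n).2
  let N : AddSubgroup G := AddSubgroup.ofSub (⋂ n, (U n).1) ⟨0, Set.mem_iInter.2 hzero⟩
    fun a ha b hb => by
      rw [← sub_eq_add_neg]
      exact Set.mem_iInter.2 fun n =>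
        hU n a (Set.mem_iInter.1 ha (n + 1)) b (Set.mem_iInter.1 hb (n + 1))
  have hN : IsClosed (N : Set G) := by
    refine isClosed_of_closure_subset fun a ha => Set.mem_iInter.2 fun n => ?_
    -- A point of the closure differs from a point of `N` by an element of `U (n + 1)`.
    have hnb : (fun b => b - a) ⁻¹' (U (n + 2)).1 ∈ 𝓝 a := by
      refine (continuous_sub_right a).continuousAt.preimage_mem_nhds ?_
      simpa using (U (n + 2)).2
    obtain ⟨b, hb, hbN⟩ := mem_closure_iff_nhds.1 ha _ hnb
    have hb' : b - a ∈ (U (n + 1)).1 := by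
      simpa using hU (n + 1) _ hb 0 (hzero (n + 2))
    have := hU n b (Set.mem_iInter.1 hbN (n + 1)) _ hb'
    simpa using this
  have hbot : N = ⊥ := (hs N inferInstance hN).resolve_right fun h => by
    have hxN : x ∈ N := h ▸ AddSubgroup.mem_top x
    have := Set.mem_iInter.1 (show x ∈ ⋂ n, (U n).1 from hxN) 0
    exact this rfl
  choose F hF hFU using fun n => hp.exists_finite_cover (U n).1 (U n).2
  have hex : ∀ (g : G) n, ∃ f : F n, g - f ∈ (U n).1 := by
    intro g n
    obtain ⟨f, hf, u, hu, rfl⟩ := Set.mem_add.1 (hFU n ▸ Set.mem_univ g)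
    exact ⟨⟨f, hf⟩, by simpa using hu⟩
  choose code hcode using hex
  have hinj : Function.Injective code := by
    intro a b hab
    have hmem : a - b ∈ N := Set.mem_iInter.2 fun n => by
      have h1 := hcode a (n + 1)
      have h2 := hcode b (n + 1)
      rw [← hab] at h2
      simpa using hU n _ h1 _ h2
    rw [hbot, AddSubgroup.mem_bot] at hmem
    exact sub_eq_zero.1 hmem
  calc #G ≤ #(∀ n, F n) := Cardinal.mk_le_of_injective hinj
    _ = Cardinal.prod fun n => #(F n) := Cardinal.mk_pi _
    _ ≤ Cardinal.prod fun _ : ℕ => (ℵ₀ : Cardinal.{u}) :=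
        Cardinal.prod_le_prod _ _ fun n => (Cardinal.le_aleph0_iff_set_countable.2 (hF n).countable)
    _ = 𝔠 := by simp

/-! ### The number of topologies of given weight -/

/-- A topology is determined by any indexed base for it. -/
theorem mk_topologies_of_weight_le (G : Type u) [Infinite G] (P : Set (TopologicalSpace G))
    (α : Cardinal.{u}) (hα : ℵ₀ ≤ α) :
    #{τ : TopologicalSpace G // τ ∈ P ∧ @topWeight G τ = α} ≤ 2 ^ (#G + α) := by
  have hex : ∀ τ : {τ : TopologicalSpace G // τ ∈ P ∧ @topWeight G τ = α},
      ∃ b : α.out → Set G, τ.1 = TopologicalSpace.generateFrom (Set.range b) := by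
    rintro ⟨τ, -, hw⟩
    obtain ⟨B, hB, hBw⟩ := @exists_isTopologicalBasis_mk_eq_topWeight G τ
    have : #B = #α.out := by rw [hBw, hw, Cardinal.mk_out]
    obtain ⟨e⟩ := Cardinal.eq.1 this
    refine ⟨fun i => e.symm i, ?_⟩
    have hr : Set.range (fun i => (e.symm i : Set G)) = B := by
      rw [Set.range_comp' , e.symm.surjective.range_eq]
      simp
    rw [hr]
    exact @TopologicalSpace.IsTopologicalBasis.eq_generateFrom G τ B hB
  choose b hb using hex
  calc _ ≤ #(α.out → Set G) := Cardinal.mk_le_of_injective (f := b) fun τ τ' h => by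
        refine Subtype.ext ?_
        rw [hb τ, hb τ', h]
    _ = 2 ^ (#G + α) := by
        rw [← Cardinal.power_def, Cardinal.mk_set, Cardinal.mk_out, ← Cardinal.power_mul,
          Cardinal.mul_eq_max (Cardinal.aleph0_le_mk G) hα,
          Cardinal.add_eq_max (Cardinal.aleph0_le_mk G)]

/-! ### Injective homomorphisms into the reals and the circle -/

theorem exists_linearIndependent_rat_real {J : Type u} (h : #J ≤ 𝔠) :
    ∃ v : J → ℝ, LinearIndependent ℚ v := by
  let b := Module.Basis.ofVectorSpace ℚ ℝ
  have hb : #(Module.Basis.ofVectorSpaceIndex ℚ ℝ) = 𝔠 := by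
    rw [b.mk_eq_rank'', Real.rank_rat_real]
  have hle : Cardinal.lift.{0} #J ≤
      Cardinal.lift.{u} #(Module.Basis.ofVectorSpaceIndex ℚ ℝ) := by
    rw [hb]; simpa using h
  obtain ⟨e⟩ := Cardinal.lift_mk_le'.1 hle
  exact ⟨_, b.linearIndependent.comp e e.injective⟩

/-- The real line embeds into the circle as an abstract group. Since `ℝ × ℚ` and `ℝ` are isomorphic
rational vector spaces, `ℝ` contains a copy of itself meeting a given line `ℚ q` only in `0`; this
copy embeds into `ℝ / ℤ q`. -/
theorem exists_injective_addChar_real : ∃ ι : AddChar ℝ Circle, Function.Injective ι := by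
  obtain ⟨Φ⟩ : Nonempty ((ℝ × ℚ) ≃ₗ[ℚ] ℝ) := by
    refine nonempty_linearEquiv_of_rank_eq ?_
    rw [rank_prod', Real.rank_rat_real, Module.rank_self,
      Cardinal.add_one_of_aleph0_le Cardinal.aleph0_le_continuum]
  have hq : Φ (0, 1) ≠ 0 := by simp
  refine ⟨⟨fun x => Circle.exp (2 * Real.pi * (Φ (x, 0) / Φ (0, 1))), by simp [← Prod.zero_eq_mk],
    fun x y => ?_⟩, ?_⟩
  · rw [← Circle.exp_add, ← mul_add, ← add_div, ← map_add, Prod.mk_add_mk, add_zero]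
  · refine AddChar.injective_iff.2 fun x hx => ?_
    have hx' : Circle.exp (2 * Real.pi * (Φ (x, 0) / Φ (0, 1))) = Circle.exp 0 := by
      simpa using hx
    obtain ⟨m, hm⟩ := Circle.exp_eq_exp.1 hx'
    have h1 : Φ (x, 0) = Φ (0, (m : ℚ)) := by
      have e : ((0 : ℝ), (m : ℚ)) = (m : ℚ) • ((0 : ℝ), (1 : ℚ)) := by simp
      rw [e, map_smul, Rat.smul_def]
      have hpi := Real.pi_ne_zero
      field_simp at hm
      push_cast
      refine mul_left_cancel₀ (mul_ne_zero two_ne_zero hpi) ?_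
      linear_combination hm
    exact (Prod.ext_iff.1 (Φ.injective h1)).1

section hull

variable {G : Type u} [AddCommGroup G]

theorem mk_divisibleHull_le : #(DivisibleHull G) ≤ max #G ℵ₀ := by
  have hsurj : Function.Surjective fun p : G × ℕ+ => DivisibleHull.mk p.1 p.2 := fun x => by
    induction x with
    | mk m s => exact ⟨(m, s), rfl⟩
  refine (Cardinal.mk_le_of_surjective hsurj).trans ?_
  rw [Cardinal.mk_prod]
  refine (Cardinal.mul_le_max _ _).trans ?_
  simp

theorem linearMap_divisibleHull_ext {f g : DivisibleHull G →ₗ[ℚ] ℝ}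
    (h : ∀ x : G, f (DivisibleHull.coeAddMonoidHom G x) = g (DivisibleHull.coeAddMonoidHom G x)) :
    f = g := by
  ext x
  induction x with
  | mk m s =>
    have e : (s : ℕ) • DivisibleHull.mk m s = DivisibleHull.coeAddMonoidHom G m := by
      rw [DivisibleHull.nsmul_mk]
      exact DivisibleHull.mk_eq_mk.2 ⟨1, by simp⟩
    have h1 := h m
    rw [← e, map_nsmul, map_nsmul] at h1
    exact smul_right_injective ℝ s.ne_zero h1

variable [IsAddTorsionFree G]

/-- Every basis of the divisible hull gives a family of injective homomorphisms to `ℝ`, obtained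
from one of them by doubling the basis vectors in an arbitrary subset. -/
theorem exists_injective_addMonoidHom_real_family {J : Type u}
    (b : Module.Basis J ℚ (DivisibleHull G)) (hJ : #J ≤ 𝔠) :
    ∃ F : Set J → (G →+ ℝ), Function.Injective F ∧ ∀ s, Function.Injective (F s) := by
  classical
  obtain ⟨v, hv⟩ := exists_linearIndependent_rat_real hJ
  let c : Set J → J → ℚˣ := fun s j => if j ∈ s then Units.mk0 2 two_ne_zero else 1
  let T : Set J → DivisibleHull G →ₗ[ℚ] ℝ := fun s => b.constr ℚ (c s • v)
  refine ⟨fun s => (T s).toAddMonoidHom.comp (DivisibleHull.coeAddMonoidHom G), ?_, fun s => ?_⟩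
  · intro s t hst
    have hT : T s = T t := linearMap_divisibleHull_ext fun x => DFunLike.congr_fun hst x
    ext j
    have hj := LinearMap.congr_fun hT (b j)
    have hne := hv.ne_zero j
    simp only [T, Module.Basis.constr_basis, Pi.smul_apply', c] at hj
    by_cases hs : j ∈ s <;> by_cases ht : j ∈ t <;>
      simp [hs, ht, Units.smul_def, Rat.smul_def, hne] at hj ⊢
  · have hinj : Function.Injective (T s) :=
      b.injective_constr_of_linearIndependent (hv.units_smul (c s))
    exact hinj.comp DivisibleHull.coe_injective

theorem exists_injective_addMonoidHom_real (hG : #G ≤ 𝔠) :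
    ∃ f : G →+ ℝ, Function.Injective f := by
  let b := Module.Basis.ofVectorSpace ℚ (DivisibleHull G)
  obtain ⟨F, -, hF⟩ := exists_injective_addMonoidHom_real_family b
    ((Cardinal.mk_le_of_injective b.injective).trans
      (mk_divisibleHull_le.trans (max_le hG Cardinal.aleph0_le_continuum)))
  exact ⟨F ∅, hF ∅⟩

theorem two_power_le_mk_injective_addMonoidHom_real (hG : #G ≤ 𝔠) (hG' : ℵ₀ < #G) :
    2 ^ #G ≤ #{f : G →+ ℝ // Function.Injective f} := by
  let b := Module.Basis.ofVectorSpace ℚ (DivisibleHull G)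
  have hV : #(DivisibleHull G) = #G :=
    le_antisymm (mk_divisibleHull_le.trans (max_le le_rfl hG'.le))
      (Cardinal.mk_le_of_injective DivisibleHull.coe_injective)
  have hJ : #(Module.Basis.ofVectorSpaceIndex ℚ (DivisibleHull G)) = #G := by
    rw [b.mk_eq_rank'', Module.Free.rank_eq_mk_of_infinite_lt, hV]
    simpa [hV] using hG'
  obtain ⟨F, hF, hF'⟩ := exists_injective_addMonoidHom_real_family b (hJ.trans_le hG)
  rw [← hJ, ← Cardinal.mk_set]
  exact Cardinal.mk_le_of_injective (f := fun s => ⟨F s, hF' s⟩) fun s t h =>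
    hF (Subtype.ext_iff.1 h)

end hull

theorem lift_mk_span_range {T : Type u} [Infinite T] {w : T → ℝ} (hw : LinearIndependent ℚ w) :
    Cardinal.lift.{u} #(Submodule.span ℚ (Set.range w)) = #T := by
  have := Cardinal.lift_mk_eq'.2 ⟨hw.linearCombinationEquiv.toEquiv⟩
  rw [Cardinal.mk_finsupp_lift_of_infinite] at this
  simpa using this.symm

/-! ### Counting topologically simple precompact topologies -/

/-- The characters `g ↦ ι (a * f g)` of `G`, depending additively on the real number `a`. -/
noncomputable def scaledChar {G : Type u} [AddCommGroup G] (ι : AddChar ℝ Circle) (f : G →+ ℝ) :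
    ℝ →+ AddChar G Circle where
  toFun a := (ι.mulShift a).compAddMonoidHom f
  map_zero' := by ext g; simp
  map_add' a b := by ext g; simp [add_mul, AddChar.map_add_eq_mul]

section count

variable {G : Type u} [AddCommGroup G] {ι : AddChar ℝ Circle}

theorem scaledChar_injective [Nontrivial G] (hι : Function.Injective ι) {f : G →+ ℝ}
    (hf : Function.Injective f) :
    Function.Injective (scaledChar ι f) := by
  intro a b hab
  obtain ⟨g, hg⟩ := exists_ne (0 : G)
  have h := hι (DFunLike.congr_fun hab g : ι (a * f g) = ι (b * f g))
  exact mul_right_cancel₀ (fun h0 => hg (hf (h0.trans (map_zero f).symm))) h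

theorem mk_map_scaledChar [Nontrivial G] (hι : Function.Injective ι) {f : G →+ ℝ}
    (hf : Function.Injective f)
    (A : AddSubgroup ℝ) :
    #(A.map (scaledChar ι f)) = Cardinal.lift.{u} #A := by
  have := Cardinal.lift_mk_eq'.2
    ⟨(A.equivMapOfInjective _ (scaledChar_injective hι hf)).toEquiv⟩
  simpa using this.symm

theorem injective_of_mem_map_scaledChar (hι : Function.Injective ι) {f : G →+ ℝ}
    (hf : Function.Injective f)
    (A : AddSubgroup ℝ) (χ : AddChar G Circle)
    (hχ : χ ∈ A.map (scaledChar ι f)) (h0 : χ ≠ 0) : Function.Injective χ := by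
  obtain ⟨a, -, rfl⟩ := hχ
  have ha : a ≠ 0 := fun h => h0 (by rw [h, map_zero])
  intro x y hxy
  exact hf (mul_left_cancel₀ ha (hι hxy))

/-- All nonzero characters in `{g ↦ ι (a * f g) | a ∈ A}` are injective, so this group generates a
topologically simple precompact topology, of weight `#A`. -/
theorem charTopology_map_scaledChar_mem [Infinite G] (hι : Function.Injective ι) {f : G →+ ℝ}
    (hf : Function.Injective f)
    (A : AddSubgroup ℝ) {α : Cardinal.{u}} (hα : ℵ₀ ≤ α)
    (hA : Cardinal.lift.{u} #A = α) :
    charTopology (A.map (scaledChar ι f)) ∈ simplePrecompactTopologies G ∧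
      @topWeight G (charTopology (A.map (scaledChar ι f))) = α := by
  have hcard : #(A.map (scaledChar ι f)) = α := (mk_map_scaledChar hι hf A).trans hA
  have hinf : Infinite (A.map (scaledChar ι f)) := Cardinal.infinite_iff.2 (hα.trans hcard.ge)
  obtain ⟨χ, hχ⟩ := exists_ne (0 : A.map (scaledChar ι f))
  have hsep : ∀ g ≠ 0, ∃ χ ∈ A.map (scaledChar ι f), χ g ≠ 1 := fun g hg =>
    ⟨χ, χ.2, fun h => hg (injective_of_mem_map_scaledChar hι hf A χ χ.2
      (fun h0 => hχ (Subtype.ext h0)) (h.trans (AddChar.map_zero_eq_one _).symm))⟩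
  refine ⟨⟨isPrecompactGroup_charTopology _ hsep,
    isTopSimpleGroup_charTopology _ (injective_of_mem_map_scaledChar hι hf A)⟩, ?_⟩
  rw [topWeight_charTopology _ (hα.trans hcard.ge) hsep, hcard]

/-- For `f` fixed and `A` running through the rational spans of subsets of an independent set,
there are `2 ^ α` topologies. Half of the independent set is kept in every span, to
ensure that `#A = α`. -/
theorem two_power_weight_le_mk_simplePrecompactTopologies [Infinite G]
    (hι : Function.Injective ι) {f : G →+ ℝ}
    (hf : Function.Injective f) {α : Cardinal.{u}} (hα : ℵ₀ ≤ α)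
    (hα' : α ≤ 𝔠) : 2 ^ α ≤
      #{τ : TopologicalSpace G // τ ∈ simplePrecompactTopologies G ∧ @topWeight G τ = α} := by
  have hI : Infinite α.out := Cardinal.infinite_iff.2 (by simpa using hα)
  obtain ⟨v, hv⟩ := exists_linearIndependent_rat_real (J := α.out ⊕ α.out)
    (by simpa [Cardinal.add_eq_self hα] using hα')
  let e : (S : Set α.out) → α.out ⊕ S → α.out ⊕ α.out := fun S => Sum.map id Subtype.val
  have he : ∀ S, Function.Injective (e S) := fun S =>
    Function.injective_id.sumMap Subtype.val_injective
  let A : Set α.out → Submodule ℚ ℝ := fun S => Submodule.span ℚ (Set.range (v ∘ e S))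
  have hA : ∀ S, Cardinal.lift.{u} #(A S).toAddSubgroup = α := by
    intro S
    refine (lift_mk_span_range (hv.comp _ (he S))).trans ?_
    rw [Cardinal.mk_sum, Cardinal.lift_id, Cardinal.lift_id, Cardinal.mk_out]
    exact Cardinal.add_eq_left hα ((Cardinal.mk_set_le S).trans (Cardinal.mk_out α).le)
  have hmem : ∀ S j, v (Sum.inr j) ∈ A S ↔ j ∈ S := by
    intro S j
    constructor
    · intro h
      by_contra hj
      refine hv.notMem_span_image (s := Set.range (e S)) (x := Sum.inr j) ?_ ?_
      · rintro ⟨k | k, hk⟩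
        · simp [e] at hk
        · exact hj ((Sum.inr_injective hk) ▸ k.2)
      · rwa [← Set.range_comp]
    · intro h
      exact Submodule.subset_span ⟨Sum.inr ⟨j, h⟩, rfl⟩
  conv_lhs => rw [← Cardinal.mk_out α, ← Cardinal.mk_set]
  refine Cardinal.mk_le_of_injective (f := fun S =>
    ⟨_, charTopology_map_scaledChar_mem hι hf (A S).toAddSubgroup hα (hA S)⟩) fun S S' h => ?_
  have h1 := AddSubgroup.map_injective (scaledChar_injective hι hf)
    (charTopology_injective (Subtype.ext_iff.1 h))
  have h2 : A S = A S' := Submodule.toAddSubgroup_injective h1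
  ext j
  rw [← hmem S, h2, hmem]

/-- For `A` fixed and `f` running through the injective homomorphisms to `ℝ`, there are `2 ^ #G`
topologies if `α < #G`: at most `α` homomorphisms give the same topology, because `f` can be
recovered up to a factor from one nonzero character, and only `α` characters are available. -/
theorem two_power_card_le_mk_simplePrecompactTopologies [Infinite G] [IsAddTorsionFree G]
    (hι : Function.Injective ι) (hG : #G ≤ 𝔠)
    {α : Cardinal.{u}} (hα : ℵ₀ ≤ α) (hα' : α < #G) : 2 ^ #G ≤
      #{τ : TopologicalSpace G // τ ∈ simplePrecompactTopologies G ∧ @topWeight G τ = α} := by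
  have hI : Infinite α.out := Cardinal.infinite_iff.2 (by simpa using hα)
  obtain ⟨v, hv⟩ := exists_linearIndependent_rat_real (J := α.out)
    (by simpa using hα'.le.trans hG)
  let A : AddSubgroup ℝ := (Submodule.span ℚ (Set.range v)).toAddSubgroup
  have hA : Cardinal.lift.{u} #A = α :=
    (lift_mk_span_range hv).trans (Cardinal.mk_out α)
  obtain ⟨i⟩ : Nonempty α.out := inferInstance
  have hi : v i ∈ A := Submodule.subset_span ⟨i, rfl⟩
  let Θ : {f : G →+ ℝ // Function.Injective f} →
      {τ : TopologicalSpace G // τ ∈ simplePrecompactTopologies G ∧ @topWeight G τ = α} :=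
    fun f => ⟨_, charTopology_map_scaledChar_mem hι f.2 A hα hA⟩
  have hfib := Cardinal.mk_le_mk_mul_of_mk_preimage_le (c := α) Θ fun τ => by
    rcases (Θ ⁻¹' {τ}).eq_empty_or_nonempty with h | ⟨f, hf⟩
    · simp [h]
    have hex : ∀ f' : Θ ⁻¹' {τ}, ∃ a : A, ∀ g, (a : ℝ) * f.1 g = v i * f'.1.1 g := by
      rintro ⟨f', hf'⟩
      have heq : A.map (scaledChar ι f'.1) = A.map (scaledChar ι f.1) :=
        charTopology_injective (Subtype.ext_iff.1 (hf'.trans hf.symm))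
      obtain ⟨a, ha, hχ⟩ : scaledChar ι f'.1 (v i) ∈ A.map (scaledChar ι f.1) :=
        heq ▸ AddSubgroup.mem_map_of_mem _ hi
      exact ⟨⟨a, ha⟩, fun g => hι (DFunLike.congr_fun hχ g)⟩
    choose a ha using hex
    have hinj : Function.Injective a := fun f₁ f₂ h => by
      refine Subtype.ext (Subtype.ext (AddMonoidHom.ext fun g => ?_))
      refine mul_left_cancel₀ (hv.ne_zero i) ?_
      rw [← ha f₁, ← ha f₂, h]
    have := Cardinal.lift_mk_le_lift_mk_of_injective hinj
    rw [hA] at this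
    simpa using this
  have h2 := (two_power_le_mk_injective_addMonoidHom_real hG (hα.trans_lt hα')).trans hfib
  by_contra! hlt
  exact (Cardinal.mul_lt_of_lt ((Cardinal.aleph0_le_mk G).trans (Cardinal.cantor _).le) hlt
    (hα'.trans (Cardinal.cantor _))).not_ge h2

end count

theorem two_power_le_mk_simplePrecompactTopologies (G : Type u) [AddCommGroup G] [Infinite G]
    [IsAddTorsionFree G] (hG : #G ≤ 𝔠) {α : Cardinal.{u}} (hα : ℵ₀ ≤ α) (hα' : α ≤ 𝔠) :
    2 ^ (#G + α) ≤
      #{τ : TopologicalSpace G // τ ∈ simplePrecompactTopologies G ∧ @topWeight G τ = α} := by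
  obtain ⟨ι, hι⟩ := exists_injective_addChar_real
  rw [Cardinal.add_eq_max (Cardinal.aleph0_le_mk G)]
  rcases le_or_gt #G α with h | h
  · rw [max_eq_right h]
    obtain ⟨f, hf⟩ := exists_injective_addMonoidHom_real hG
    exact two_power_weight_le_mk_simplePrecompactTopologies hι hf hα hα'
  · rw [max_eq_left h.le]
    exact two_power_card_le_mk_simplePrecompactTopologies hι hG hα h

theorem mainTheorem7 (G : Type u) [AddCommGroup G] [Infinite G] :
    ((simplePrecompactTopologies G).Nonempty ↔ IsAddTorsionFree G ∧ #G ≤ 𝔠) ∧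
    (IsAddTorsionFree G → #G ≤ 𝔠 → ∀ α : Cardinal.{u}, ℵ₀ ≤ α → α ≤ 𝔠 →
      #{τ : TopologicalSpace G // τ ∈ simplePrecompactTopologies G ∧ @topWeight G τ = α} =
        2 ^ (#G + α)) := by
  refine ⟨⟨?_, ?_⟩, ?_⟩
  · rintro ⟨τ, hp, hs⟩
    have := hp.hausdorff
    exact ⟨isAddTorsionFree_of_isTopSimpleGroup hs, mk_le_continuum_of_isTopSimpleGroup hp hs⟩
  · rintro ⟨_, hG⟩
    obtain ⟨ι, hι⟩ := exists_injective_addChar_real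
    obtain ⟨f, hf⟩ := exists_injective_addMonoidHom_real hG
    have h := two_power_weight_le_mk_simplePrecompactTopologies hι hf le_rfl
      Cardinal.aleph0_le_continuum
    obtain ⟨τ⟩ := Cardinal.mk_ne_zero_iff.1
      ((Cardinal.power_pos _ (zero_lt_two' Cardinal)).trans_le h).ne'
    exact ⟨τ.1, τ.2.1⟩
  · intro _ hG α hα hα'
    exact le_antisymm (mk_topologies_of_weight_le G _ α hα)
      (two_power_le_mk_simplePrecompactTopologies G hG hα hα')
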